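/- **Setting.** Let $m\ge 2$, $d\ge 0$, $0<\mu\le L$. Let $f_1,\dots,f_m:\mathbb{R}^d\to\mathbb{R}$ be convex and $L$-smooth, i.e. differentiable with $$f_i(x)+\langle\nabla f_i(x),y-x\rangle\le f_i(y)\le f_i(x)+\langle\nabla f_i(x),y-x\rangle+\tfrac L2\|x-y\|^2\qquad\text{for all }x,y\in\mathbb{R}^d,$$ let $g:\mathbb{R}^d\to\mathbb{R}$ be $\mu$-strongly convex (not necessarily differentiable), let $F(x)=\frac1m\sum_{i=1}^m f_i(x)+g(x)$, and let $x^*$ be a minimizer of $F$. Let $W\in\mathbb{R}^{m\times m}$ be a weight matrix of a network on the agents $1,\dots,m$: $W$ is symmetric, $W_{ij}\neq0$ if and only if $i=j$ or $i,j$ are neighbours, $0\preceq W\preceq I$, $W\mathbf 1=\mathbf 1$ and $\mathrm{null}(I-W)=\mathrm{span}(\mathbf 1)$. Let $\lambda_2(W)$ be its second largest eigenvalue (with multiplicity). For $\mathbf x\in\mathbb{R}^{m\times d}$ with rows $\mathbf x^{(i)}$, let $\|\mathbf x\|$ be the Frobenius norm, $\overline x=\frac1m\sum_i\mathbf x^{(i)}$,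 $\Pi=I-\frac1m\mathbf 1\mathbf 1^\top$, $\nabla f(\mathbf x)$ the matrix with rows $\nabla f_i(\mathbf x^{(i)})$, and $\mathrm{prox}_{\gamma g}(\mathbf x)$ the matrix with rows $\mathrm{argmin}_{w\in\mathbb{R}^d}\big(\gamma g(w)+\frac12\|w-\mathbf x^{(i)}\|^2\big)$. Let $\mathrm{FastMix}(\mathbf x,K)=\mathbf x^K$, where $\mathbf x^0=\mathbf x^1=\mathbf x$, $\mathbf x^{k+1}=(1+\eta_w)W\mathbf x^k-\eta_w\mathbf x^{k-1}$ for $k\ge1$, and $\eta_w=1/(1+\sqrt{1-\lambda_2(W)^2})$. **Algorithm (ODAPG).** Given $x_1\in\mathbb{R}^d$ and parameters $\gamma,\tau,K$, set $\mathbf x_1=\mathbf y_1=\mathbf z_1=\mathbf 1x_1$ and $\mathbf s_1=\nabla f(\mathbf x_1)$, and for $t\ge1$ $$\begin{aligned}\mathbf x_{t+1}&=\tau\mathbf z_t+(1-\tau)\mathbf y_t,\\ \mathbf s_{t+1}&=\mathrm{FastMix}\big(\mathbf s_t+\nabla f(\mathbf x_{t+1})-\nabla f(\mathbf x_t),K\big),\\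 \mathbf z_{t+1}&=\mathrm{FastMix}\big(\mathrm{prox}_{\gamma g}(\mathbf z_t-\gamma\mathbf s_{t+1}),K\big),\\ \mathbf y_{t+1}&=\mathrm{FastMix}\big(\tau\mathbf z_{t+1}+(1-\tau)\mathbf y_t,K\big).\end{aligned}$$ **Theorem.** Let $\gamma=\frac1{20\sqrt{L\mu}}$, $\tau=\mu\gamma$, and let $K$ be any integer with $K\ge\frac{15}{\sqrt{1-\lambda_2(W)}}$ (for instance this number, rounded up). Then for every $x_1\in\mathbb{R}^d$ and every $T\ge1$, $$\begin{aligned}\|\mathbf z_T-\mathbf 1x^*\|^2\le\Big(1-\tfrac1{40}\sqrt{\tfrac\mu L}\Big)^T\Big(&\tfrac{2m}{\mu}\big(F(\overline y_1)-F(x^*)\big)+\|\mathbf z_1-\mathbf 1x^*\|^2\\&+\tfrac{6\cdot20^2L}{\mu}\big(\|\Pi\mathbf x_1\|^2+c_1\|\Pi\mathbf y_1\|^2+c_2\|\Pi\mathbf z_1\|^2+c_3\gamma^2\|\Pi\mathbf s_1\|^2\big)\Big),\end{aligned}$$ with $c_1=64$, $c_2=\frac{9\tau^2}{32}$, $c_3=\frac{5\tau^2}{14}$.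 -/

import Mathlib

open scoped InnerProductSpace Gradient

noncomputable section

namespace ODAPG

/-- The space `ℝᵈ` with its Euclidean norm and inner product. -/
abbrev Vec (d : ℕ) := EuclideanSpace ℝ (Fin d)

/-- An `m × d` real matrix, given by its rows: row `i` is the local copy held by agent `i`. -/
abbrev Rows (m d : ℕ) := Fin m → Vec d

variable {m d : ℕ}

/-- The squared Frobenius norm of a matrix given by its rows. -/
def frobSq (x : Rows m d) : ℝ := ∑ i, ∑ j, (x i j) ^ 2

/-- The average of the rows. -/
def avg (x : Rows m d) : Vec d := (1 / (m : ℝ)) • ∑ i, x i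

/-- The matrix `𝟏 v` all of whose rows are equal to `v`. -/
def ones (v : Vec d) : Rows m d := fun _ => v

/-- The left product `A x` of an `m × m` matrix with an `m × d` matrix. -/
def lmul (A : Matrix (Fin m) (Fin m) ℝ) (x : Rows m d) : Rows m d :=
  fun i => ∑ j, A i j • x j

/-- The projection matrix `Π = I - 𝟏𝟏ᵀ / m`. -/
def projMat (m : ℕ) : Matrix (Fin m) (Fin m) ℝ :=
  1 - (1 / (m : ℝ)) • Matrix.of (fun _ _ => (1 : ℝ))

/-- `f` is convex and `L`-smooth on `ℝᵈ`. -/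
structure IsConvexSmooth (L : ℝ) (f : Vec d → ℝ) : Prop where
  differentiable : Differentiable ℝ f
  lower : ∀ x y : Vec d, f x + ⟪∇ f x, y - x⟫_ℝ ≤ f y
  upper : ∀ x y : Vec d, f y ≤ f x + ⟪∇ f x, y - x⟫_ℝ + L / 2 * ‖x - y‖ ^ 2

/-- `W` is a weight matrix of the network `G`.  (The kernel condition forces `G` to be
connected.) -/
structure IsWeightMatrix (G : SimpleGraph (Fin m)) (W : Matrix (Fin m) (Fin m) ℝ) : Prop where
  isHermitian : W.IsHermitian
  support : ∀ i j, W i j ≠ 0 ↔ (G.Adj i j ∨ i = j)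
  posSemidef : W.PosSemidef
  le_one : (1 - W).PosSemidef
  mulVec_one : Matrix.mulVec W (fun _ => (1 : ℝ)) = fun _ => 1
  ker_eq : LinearMap.ker (Matrix.toLin' (1 - W)) = Submodule.span ℝ {fun _ : Fin m => (1 : ℝ)}

/-- The second largest eigenvalue, counted with multiplicity, of a real symmetric matrix of
size `m ≥ 2`; `eigenvalues₀` lists the eigenvalues in decreasing order, starting at index `0`. -/
def lambda2 (hm : 2 ≤ m) {W : Matrix (Fin m) (Fin m) ℝ} (hW : W.IsHermitian) : ℝ :=
  hW.eigenvalues₀ ⟨1, by rw [Fintype.card_fin]; omega⟩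

/-- The `FastMix` sequence: `x⁰ = x¹ = x`, `xᵏ⁺¹ = (1 + η) W xᵏ - η xᵏ⁻¹`. -/
def fastMixSeq (W : Matrix (Fin m) (Fin m) ℝ) (η : ℝ) (x : Rows m d) : ℕ → Rows m d
  | 0 => x
  | 1 => x
  | k + 2 => (1 + η) • lmul W (fastMixSeq W η x (k + 1)) - η • fastMixSeq W η x k

/-- The output `xᴷ` of `FastMix` on input `x`. -/
def fastMix (W : Matrix (Fin m) (Fin m) ℝ) (η : ℝ) (K : ℕ) (x : Rows m d) : Rows m d :=
  fastMixSeq W η x K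

/-- The parameter of `FastMix`, as a function of the second largest eigenvalue. -/
def mixParam (lam : ℝ) : ℝ := 1 / (1 + √(1 - lam ^ 2))

/-- The proximal operator: a minimizer of `w ↦ γ g(w) + ‖w - v‖² / 2`. -/
def prox (γ : ℝ) (g : Vec d → ℝ) (v : Vec d) : Vec d :=
  Classical.epsilon fun w =>
    IsMinOn (fun u => γ * g u + 1 / 2 * ‖u - v‖ ^ 2) Set.univ w

/-- The proximal operator applied to each row. -/
def proxRows (γ : ℝ) (g : Vec d → ℝ) (x : Rows m d) : Rows m d := fun i => prox γ g (x i)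

/-- The aggregate gradient: row `i` is `∇ fᵢ` at row `i` of `x`. -/
def gradRows (f : Fin m → Vec d → ℝ) (x : Rows m d) : Rows m d := fun i => ∇ (f i) (x i)

/-- The objective `F = (1/m) ∑ᵢ fᵢ + g`. -/
def objective (f : Fin m → Vec d → ℝ) (g : Vec d → ℝ) (x : Vec d) : ℝ :=
  1 / (m : ℝ) * ∑ i, f i x + g x

/-- The four matrices maintained by the algorithm. -/
structure State (m d : ℕ) where
  x : Rows m d
  y : Rows m d
  z : Rows m d
  s : Rows m d

/-- The initialization `x = y = z = 𝟏 x₁`, `s = ∇ f (x)`. -/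
def initState (f : Fin m → Vec d → ℝ) (x₁ : Vec d) : State m d where
  x := ones x₁
  y := ones x₁
  z := ones x₁
  s := gradRows f (ones x₁)

/-- One iteration of the algorithm; `mix` is the averaging subroutine. -/
def step (f : Fin m → Vec d → ℝ) (g : Vec d → ℝ) (mix : Rows m d → Rows m d) (γ τ : ℝ)
    (S : State m d) : State m d :=
  let x' := τ • S.z + (1 - τ) • S.y
  let s' := mix (S.s + gradRows f x' - gradRows f S.x)
  let z' := mix (proxRows γ g (S.z - γ • s'))
  let y' := mix (τ • z' + (1 - τ) • S.y)
  { x := x', y := y', z := z', s := s' }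

/-- The iterates of the algorithm with constant step sizes, numbered from `t = 1`: the initial
matrices have number `1` (the value at `0` is a dummy). -/
def iterate (f : Fin m → Vec d → ℝ) (g : Vec d → ℝ) (mix : Rows m d → Rows m d) (γ τ : ℝ)
    (x₁ : Vec d) : ℕ → State m d
  | 0 => initState f x₁
  | 1 => initState f x₁
  | t + 2 => step f g mix γ τ (iterate f g mix γ τ x₁ (t + 1))

end ODAPG

end

noncomputable section

open scoped InnerProductSpace Gradient

namespace ODAPG

section Rows

variable {m d : ℕ}

lemma frobSq_eq (x : Rows m d) : frobSq x = ∑ i, ‖x i‖ ^ 2 := by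
  simp [frobSq, EuclideanSpace.norm_sq_eq]

lemma frobSq_nonneg (x : Rows m d) : 0 ≤ frobSq x := by
  rw [frobSq_eq]; positivity

/-- The deviation of the rows from their average. -/
def dev (x : Rows m d) : Rows m d := x - ones (avg x)

lemma lmul_projMat (x : Rows m d) : lmul (projMat m) x = dev x := by
  ext1 i
  simp only [lmul, projMat, dev, ones, avg, Pi.sub_apply, Matrix.sub_apply, Matrix.smul_apply,
    Matrix.of_apply, smul_eq_mul, mul_one, sub_smul, Finset.sum_sub_distrib, Finset.smul_sum]
  congr 1
  simp [Matrix.one_apply]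

lemma avg_add (x y : Rows m d) : avg (x + y) = avg x + avg y := by
  simp [avg, Finset.sum_add_distrib]

lemma avg_sub (x y : Rows m d) : avg (x - y) = avg x - avg y := by
  simp [avg, Finset.sum_sub_distrib, smul_sub]

lemma avg_smul (c : ℝ) (x : Rows m d) : avg (c • x) = c • avg x := by
  simp [avg, ← Finset.smul_sum, smul_comm c]

lemma avg_ones (hm : m ≠ 0) (v : Vec d) : avg (ones v : Rows m d) = v := by
  have : (m : ℝ) ≠ 0 := by exact_mod_cast hm
  simp [avg, ones, ← Nat.cast_smul_eq_nsmul ℝ, smul_smul, this]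

lemma sum_rows (hm : m ≠ 0) (x : Rows m d) : ∑ i, x i = (m : ℝ) • avg x := by
  have : (m : ℝ) ≠ 0 := by exact_mod_cast hm
  simp [avg, smul_smul, this]

lemma dev_add (x y : Rows m d) : dev (x + y) = dev x + dev y := by
  ext1 i; simp only [dev, avg_add, ones, Pi.sub_apply, Pi.add_apply]; abel

lemma dev_sub (x y : Rows m d) : dev (x - y) = dev x - dev y := by
  ext1 i; simp only [dev, avg_sub, ones, Pi.sub_apply]; abel

lemma dev_smul (c : ℝ) (x : Rows m d) : dev (c • x) = c • dev x := by
  ext1 i; simp only [dev, avg_smul, ones, Pi.sub_apply, Pi.smul_apply, smul_sub]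

lemma dev_ones (hm : m ≠ 0) (v : Vec d) : dev (ones v : Rows m d) = 0 := by
  ext1 i; simp [dev, avg_ones hm, ones]

lemma avg_dev (hm : m ≠ 0) (x : Rows m d) : avg (dev x) = 0 := by
  rw [dev, avg_sub, avg_ones hm, sub_self]

lemma sum_dev (hm : m ≠ 0) (x : Rows m d) : ∑ i, dev x i = 0 := by
  rw [sum_rows hm, avg_dev hm, smul_zero]

lemma dev_add_avg (x : Rows m d) (i : Fin m) : x i = avg x + dev x i := by
  simp [dev, ones]

lemma frobSq_smul (c : ℝ) (x : Rows m d) : frobSq (c • x) = c ^ 2 * frobSq x := by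
  simp [frobSq_eq, norm_smul, mul_pow, Finset.mul_sum]

lemma frobSq_zero : frobSq (0 : Rows m d) = 0 := by
  simp [frobSq_eq]

lemma frobSq_sub_ones (hm : m ≠ 0) (x : Rows m d) (v : Vec d) :
    frobSq (x - ones v) = frobSq (dev x) + m * ‖avg x - v‖ ^ 2 := by
  have h : ∀ i : Fin m, ‖(x - ones v : Rows m d) i‖ ^ 2
      = ‖dev x i‖ ^ 2 + 2 * ⟪dev x i, avg x - v⟫_ℝ + ‖avg x - v‖ ^ 2 := by
    intro i
    rw [← norm_add_sq_real]
    simp [dev, ones]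
  simp only [frobSq_eq, h, Finset.sum_add_distrib, ← Finset.mul_sum, ← sum_inner, sum_dev hm]
  simp

lemma frobSq_dev_le (hm : m ≠ 0) (x : Rows m d) : frobSq (dev x) ≤ frobSq x := by
  have h := frobSq_sub_ones hm x 0
  have h0 : x - ones 0 = x := by ext1 i; simp [ones]
  rw [h0] at h
  have : 0 ≤ (m : ℝ) * ‖avg x - 0‖ ^ 2 := by positivity
  linarith

lemma sq_norm_add_le {E : Type*} [NormedAddCommGroup E] (a b : E) :
    ‖a + b‖ ^ 2 ≤ 2 * (‖a‖ ^ 2 + ‖b‖ ^ 2) := by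
  have := norm_add_le a b
  have := norm_nonneg (a + b)
  nlinarith [sq_nonneg (‖a‖ - ‖b‖)]

lemma frobSq_add_le (x y : Rows m d) : frobSq (x + y) ≤ 2 * (frobSq x + frobSq y) := by
  simp only [frobSq_eq, ← Finset.sum_add_distrib, Finset.mul_sum]
  exact Finset.sum_le_sum fun i _ => sq_norm_add_le _ _

lemma frobSq_add_three_le (x y z : Rows m d) :
    frobSq (x + y + z) ≤ 3 * (frobSq x + frobSq y + frobSq z) := by
  simp only [frobSq_eq, ← Finset.sum_add_distrib, Finset.mul_sum]
  refine Finset.sum_le_sum fun i _ => ?_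
  have h := norm_add₃_le (a := x i) (b := y i) (c := z i)
  have := norm_nonneg (x i + y i + z i)
  simp only [Pi.add_apply]
  nlinarith [sq_nonneg (‖x i‖ - ‖y i‖), sq_nonneg (‖x i‖ - ‖z i‖), sq_nonneg (‖y i‖ - ‖z i‖)]

lemma sum_inner_rows (hm : m ≠ 0) (x y : Rows m d) :
    ∑ i, ⟪x i, y i⟫_ℝ = m * ⟪avg x, avg y⟫_ℝ + ∑ i, ⟪dev x i, dev y i⟫_ℝ := by
  have h : ∀ i, ⟪x i, y i⟫_ℝ = ⟪avg x, avg y⟫_ℝ + ⟪avg x, dev y i⟫_ℝ + ⟪dev x i, avg y⟫_ℝ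
      + ⟪dev x i, dev y i⟫_ℝ := by
    intro i
    conv_lhs => rw [dev_add_avg x i, dev_add_avg y i]
    rw [inner_add_left, inner_add_right, inner_add_right]
    ring
  simp only [h, Finset.sum_add_distrib, ← sum_inner, ← inner_sum, sum_dev hm]
  simp [← Nat.cast_smul_eq_nsmul ℝ, real_inner_smul_left]

end Rows

section FastMix

variable {m d : ℕ}

/-- The scalar version of the `FastMix` recursion, at an eigenvalue `w`. -/
def mixPoly (η w : ℝ) : ℕ → ℝ
  | 0 => 1
  | 1 => 1
  | k + 2 => (1 + η) * w * mixPoly η w (k + 1) - η * mixPoly η w k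

lemma mixPoly_energy (η w : ℝ) (k : ℕ) :
    mixPoly η w (k + 1) ^ 2 - (1 + η) * w * mixPoly η w (k + 1) * mixPoly η w k
      + η * mixPoly η w k ^ 2 = η ^ k * ((1 + η) * (1 - w)) := by
  induction k with
  | zero => simp [mixPoly]; ring
  | succ k ih =>
    rw [show η ^ (k + 1) * ((1 + η) * (1 - w)) = η * (η ^ k * ((1 + η) * (1 - w))) by ring, ← ih]
    simp only [mixPoly]
    ring

lemma mixPoly_energy_lower (η w : ℝ) (k : ℕ) :
    (η - ((1 + η) * w) ^ 2 / 4) * mixPoly η w k ^ 2 ≤ η ^ k * ((1 + η) * (1 - w)) := by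
  rw [← mixPoly_energy]
  nlinarith [sq_nonneg (mixPoly η w (k + 1) - (1 + η) * w / 2 * mixPoly η w k)]

lemma mixPoly_quadratic_pos {lam s w : ℝ} (hs : 0 < s) (hs1 : s ≤ 1) (hsl : s ^ 2 + lam ^ 2 = 1)
    (hl : lam < 1) (hw : 0 ≤ w) (hwl : w ≤ lam) :
    4 * (2 + s) * (1 + s) * (1 - w) ≤ 3 * (4 * (1 + s) - (2 + s) ^ 2 * w ^ 2) ∧
      0 < 4 * (1 + s) - (2 + s) ^ 2 * w ^ 2 := by
  have hw2 : w ^ 2 ≤ lam * w := by nlinarith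
  have hwl2 : w ^ 2 ≤ lam ^ 2 := by nlinarith
  have hlam2 : lam ^ 2 = 1 - s ^ 2 := by linarith
  have pos : 0 < 4 * (1 + s) - (2 + s) ^ 2 * w ^ 2 := by
    have : (2 + s) ^ 2 * w ^ 2 ≤ (2 + s) ^ 2 * (1 - s ^ 2) := by gcongr; linarith
    nlinarith [mul_pos hs hs, mul_pos (mul_pos hs hs) hs, mul_pos (mul_pos hs hs) (mul_pos hs hs)]
  refine ⟨?_, pos⟩
  -- the difference is concave in `w`, so it suffices to check the ends of `[0, lam]`
  rcases eq_or_lt_of_le (hw.trans hwl) with h0 | hlpos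
  · have : w = 0 := by linarith
    subst this
    nlinarith
  have hend : 4 * (2 + s) * (1 + s) * (1 - lam) ≤ 3 * (4 * (1 + s) - (2 + s) ^ 2 * lam ^ 2) := by
    have h1 : 4 * (1 + s) - (2 + s) ^ 2 * lam ^ 2 = (1 + s) * s ^ 2 * (3 + s) := by
      rw [hlam2]; ring
    have h2 : s ^ 2 = (1 - lam) * (1 + lam) := by rw [← sub_eq_zero]; linarith
    have h3 : 4 * (2 + s) ≤ 3 * ((1 + lam) * (3 + s)) := by nlinarith
    rw [h1, h2]
    have h4 : 0 ≤ (1 + s) * (1 - lam) := mul_nonneg (by linarith) (by linarith)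
    nlinarith [mul_le_mul_of_nonneg_left h3 h4]
  have h5 : 4 * (2 + s) * (1 + s) ≤ 12 * (1 + s) := by nlinarith
  have h6 : 3 * (2 + s) ^ 2 * w ^ 2 ≤ 3 * (2 + s) ^ 2 * (lam * w) := by gcongr
  have h7 := mul_le_mul_of_nonneg_left hend hw
  have h8 := mul_le_mul_of_nonneg_left h5 (sub_nonneg.2 hwl)
  have : 0 ≤ lam * (3 * (4 * (1 + s) - (2 + s) ^ 2 * w ^ 2) - 4 * (2 + s) * (1 + s) * (1 - w)) := by
    nlinarith [mul_le_mul_of_nonneg_left h6 hlpos.le]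
  exact sub_nonneg.1 (nonneg_of_mul_nonneg_right this hlpos)

/-- On eigenvalues in `[0, lam]`, the `FastMix` polynomial contracts at the accelerated rate. -/
lemma mixPoly_sq_le {lam w : ℝ} (hl : lam < 1) (hw : 0 ≤ w) (hwl : w ≤ lam) (k : ℕ) :
    mixPoly (mixParam lam) w k ^ 2 ≤ 3 * mixParam lam ^ k := by
  have hl2 : 0 < 1 - lam ^ 2 := by nlinarith
  obtain ⟨s, hsdef⟩ : ∃ s, s = √(1 - lam ^ 2) := ⟨_, rfl⟩
  have hs : 0 < s := hsdef ▸ Real.sqrt_pos.2 hl2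
  have hs2 : s ^ 2 = 1 - lam ^ 2 := by rw [hsdef, Real.sq_sqrt hl2.le]
  have hs1 : s ≤ 1 := by nlinarith
  have hη : mixParam lam = 1 / (1 + s) := by rw [mixParam, hsdef]
  rw [hη]
  set η := 1 / (1 + s) with hηdef
  have hη0 : 0 < η := by positivity
  obtain ⟨hA, hB⟩ := mixPoly_quadratic_pos hs hs1 (by linarith) hl hw hwl
  have e1 : η - ((1 + η) * w) ^ 2 / 4
      = (4 * (1 + s) - (2 + s) ^ 2 * w ^ 2) * (1 / (4 * (1 + s) ^ 2)) := by
    rw [hηdef]; field_simp; ring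
  have e2 : (1 + η) * (1 - w) = (4 * (2 + s) * (1 + s) * (1 - w)) * (1 / (4 * (1 + s) ^ 2)) := by
    rw [hηdef]; field_simp; ring
  have hpos : 0 < η - ((1 + η) * w) ^ 2 / 4 := by rw [e1]; positivity
  have hle : (1 + η) * (1 - w) ≤ 3 * (η - ((1 + η) * w) ^ 2 / 4) := by
    rw [e1, e2, ← mul_assoc]; gcongr
  have hmain := mixPoly_energy_lower η w k
  have : (η - ((1 + η) * w) ^ 2 / 4) * mixPoly η w k ^ 2
      ≤ (η - ((1 + η) * w) ^ 2 / 4) * (3 * η ^ k) := by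
    calc _ ≤ _ := hmain
      _ ≤ η ^ k * (3 * (η - ((1 + η) * w) ^ 2 / 4)) := by gcongr
      _ = _ := by ring
  exact le_of_mul_le_mul_left this hpos

lemma mixParam_pow_le {lam : ℝ} (hl0 : 0 ≤ lam) (hl : lam < 1) {K : ℕ}
    (hK : 15 / √(1 - lam) ≤ K) : mixParam lam ^ K ≤ 1 / 2 ^ 15 := by
  set u := √(1 - lam) with hu
  have hu0 : 0 < u := Real.sqrt_pos.2 (by linarith)
  have hu1 : u ≤ 1 := Real.sqrt_le_one.2 (by linarith)
  have hus : u ≤ √(1 - lam ^ 2) := Real.sqrt_le_sqrt (by nlinarith)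
  have h2 : (2 : ℝ) ≤ (1 + u) ^ (1 / u) := by
    have := one_add_mul_self_le_rpow_one_add (s := u) (by linarith) (p := 1 / u)
      ((one_le_div hu0).2 hu1)
    rwa [one_div_mul_cancel hu0.ne', one_add_one_eq_two] at this
  have hKu : (15 : ℝ) ≤ u * K := by rw [div_le_iff₀ hu0] at hK; linarith
  have h3 : (2 : ℝ) ^ 15 ≤ (1 + u) ^ K := by
    calc (2 : ℝ) ^ 15 = (2 : ℝ) ^ (15 : ℝ) := by norm_cast
      _ ≤ (2 : ℝ) ^ (u * K) := Real.rpow_le_rpow_of_exponent_le one_le_two hKu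
      _ ≤ ((1 + u) ^ (1 / u)) ^ (u * K) := Real.rpow_le_rpow zero_le_two h2 (by positivity)
      _ = (1 + u) ^ K := by
        rw [← Real.rpow_mul (by positivity), ← mul_assoc, one_div_mul_cancel hu0.ne', one_mul,
          Real.rpow_natCast]
  rw [mixParam, div_pow, one_pow]
  apply one_div_le_one_div_of_le (by positivity)
  exact h3.trans (by gcongr)

/-- The combination of the rows of `x` with coefficients `v`. -/
def coef (v : EuclideanSpace ℝ (Fin m)) (x : Rows m d) : Vec d := ∑ l, v l • x l

lemma coef_lmul {W : Matrix (Fin m) (Fin m) ℝ} (hW : W.IsHermitian)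
    {v : EuclideanSpace ℝ (Fin m)} {w : ℝ} (hv : W.mulVec v = w • (v : Fin m → ℝ))
    (x : Rows m d) : coef v (lmul W x) = w • coef v x := by
  have hsym : ∀ i j, W i j = W j i := fun i j => by simpa using (hW.apply i j).symm
  have hv' : ∀ j, ∑ l, v l * W l j = w * v j := by
    intro j
    have := congrFun hv j
    simp only [Matrix.mulVec, dotProduct, Pi.smul_apply, smul_eq_mul] at this
    rw [← this]
    exact Finset.sum_congr rfl fun l _ => by rw [hsym l j, mul_comm]
  simp only [coef, lmul, Finset.smul_sum, smul_smul]
  rw [Finset.sum_comm]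
  simp only [← Finset.sum_smul, hv']

lemma coef_fastMixSeq {W : Matrix (Fin m) (Fin m) ℝ} (hW : W.IsHermitian)
    {v : EuclideanSpace ℝ (Fin m)} {w : ℝ} (hv : W.mulVec v = w • (v : Fin m → ℝ)) (η : ℝ)
    (x : Rows m d) : ∀ k, coef v (fastMixSeq W η x k) = mixPoly η w k • coef v x
  | 0 => by simp [fastMixSeq, mixPoly]
  | 1 => by simp [fastMixSeq, mixPoly]
  | k + 2 => by
    have hlin : ∀ (a b : ℝ) (y z : Rows m d), coef v (a • y - b • z) = a • coef v y - b • coef v z := by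
      intro a b y z
      simp [coef, smul_sub, Finset.sum_sub_distrib, Finset.smul_sum, smul_comm (v _)]
    rw [fastMixSeq, hlin, coef_lmul hW hv, coef_fastMixSeq hW hv η x (k + 1),
      coef_fastMixSeq hW hv η x k, mixPoly]
    simp only [smul_smul, sub_smul, mul_assoc]

lemma sum_norm_coef_sq (b : OrthonormalBasis (Fin m) ℝ (EuclideanSpace ℝ (Fin m)))
    (x : Rows m d) : ∑ i, ‖coef (b i) x‖ ^ 2 = frobSq x := by
  have h1 : ∀ i, ‖coef (b i) x‖ ^ 2
      = ∑ c, ‖⟪b i, (WithLp.toLp 2 fun l => x l c : EuclideanSpace ℝ (Fin m))⟫_ℝ‖ ^ 2 := by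
    intro i
    rw [EuclideanSpace.norm_sq_eq]
    refine Finset.sum_congr rfl fun c _ => ?_
    congr 2
    simp [coef, PiLp.inner_apply, mul_comm]
  simp only [h1]
  rw [Finset.sum_comm]
  simp only [b.sum_sq_norm_inner_right, EuclideanSpace.norm_sq_eq, frobSq]
  rw [Finset.sum_comm]
  simp

/-- The all-ones vector. -/
def onesVec (m : ℕ) : EuclideanSpace ℝ (Fin m) := WithLp.toLp 2 fun _ => 1

lemma avg_eq_coef (x : Rows m d) : avg x = (1 / (m : ℝ)) • coef (onesVec m) x := by
  simp [avg, coef, onesVec]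

lemma mixPoly_one (η : ℝ) : ∀ k, mixPoly η 1 k = 1
  | 0 => rfl
  | 1 => rfl
  | k + 2 => by rw [mixPoly, mixPoly_one η (k + 1), mixPoly_one η k]; ring

variable {G : SimpleGraph (Fin m)} {W : Matrix (Fin m) (Fin m) ℝ}

lemma IsWeightMatrix.avg_fastMix (hW : IsWeightMatrix G W) (η : ℝ) (K : ℕ) (x : Rows m d) :
    avg (fastMix W η K x) = avg x := by
  have h : W.mulVec (onesVec m) = (1 : ℝ) • (onesVec m : Fin m → ℝ) := by
    simpa [onesVec] using hW.mulVec_one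
  rw [avg_eq_coef, avg_eq_coef, fastMix, coef_fastMixSeq hW.isHermitian h, mixPoly_one, one_smul]

lemma IsWeightMatrix.eigenvalues_nonneg (hW : IsWeightMatrix G W) (i : Fin m) :
    0 ≤ hW.isHermitian.eigenvalues i := hW.posSemidef.eigenvalues_nonneg i

lemma IsWeightMatrix.eigenvalues_le_one (hW : IsWeightMatrix G W) (i : Fin m) :
    hW.isHermitian.eigenvalues i ≤ 1 := by
  set v := hW.isHermitian.eigenvectorBasis i with hv
  have h := hW.le_one.dotProduct_mulVec_nonneg (v : Fin m → ℝ)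
  have hn : star (v : Fin m → ℝ) ⬝ᵥ (v : Fin m → ℝ) = 1 := by
    have h1 := EuclideanSpace.norm_sq_eq v
    rw [show ‖v‖ = 1 from hW.isHermitian.eigenvectorBasis.orthonormal.1 i, one_pow] at h1
    simpa [dotProduct, ← pow_two] using h1.symm
  rw [Matrix.sub_mulVec, Matrix.one_mulVec, hW.isHermitian.mulVec_eigenvectorBasis, ← hv,
    dotProduct_sub, dotProduct_smul, hn] at h
  simpa using h

lemma IsWeightMatrix.eigenvector_of_eq_one (hW : IsWeightMatrix G W) {i : Fin m}
    (hi : hW.isHermitian.eigenvalues i = 1) :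
    ∃ c : ℝ, hW.isHermitian.eigenvectorBasis i = c • onesVec m := by
  have h : (hW.isHermitian.eigenvectorBasis i : Fin m → ℝ)
      ∈ LinearMap.ker (Matrix.toLin' (1 - W)) := by
    rw [LinearMap.mem_ker, Matrix.toLin'_apply, Matrix.sub_mulVec, Matrix.one_mulVec,
      hW.isHermitian.mulVec_eigenvectorBasis, hi, one_smul, sub_self]
  rw [hW.ker_eq, Submodule.mem_span_singleton] at h
  obtain ⟨c, hc⟩ := h
  refine ⟨c, ?_⟩
  ext l
  simpa [onesVec] using (congrFun hc l).symm

lemma IsWeightMatrix.sum_eigenvector (hW : IsWeightMatrix G W) {i : Fin m}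
    (hi : hW.isHermitian.eigenvalues i ≠ 1) :
    ∑ l, hW.isHermitian.eigenvectorBasis i l = 0 := by
  set v := hW.isHermitian.eigenvectorBasis i with hv
  have hsym : ∀ i j, W i j = W j i := fun i j => by
    simpa using (hW.isHermitian.apply i j).symm
  have h1 : ∑ l, W.mulVec v l = ∑ l, v l := by
    simp only [Matrix.mulVec, dotProduct]
    rw [Finset.sum_comm]
    refine Finset.sum_congr rfl fun j _ => ?_
    rw [← Finset.sum_mul]
    have := congrFun hW.mulVec_one j
    simp only [Matrix.mulVec, dotProduct, mul_one] at this
    simp only [hsym _ j, this, one_mul]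
  rw [hW.isHermitian.mulVec_eigenvectorBasis, ← hv] at h1
  simp only [Pi.smul_apply, smul_eq_mul, ← Finset.mul_sum] at h1
  have h2 : (hW.isHermitian.eigenvalues i - 1) * ∑ l, v l = 0 := by linarith
  exact (mul_eq_zero.1 h2).resolve_left (sub_ne_zero.2 hi)

lemma IsWeightMatrix.eq_of_eigenvalues_eq_one (hW : IsWeightMatrix G W) {i j : Fin m}
    (hi : hW.isHermitian.eigenvalues i = 1) (hj : hW.isHermitian.eigenvalues j = 1) : i = j := by
  by_contra hij
  obtain ⟨a, ha⟩ := hW.eigenvector_of_eq_one hi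
  obtain ⟨b, hb⟩ := hW.eigenvector_of_eq_one hj
  have hon := hW.isHermitian.eigenvectorBasis.orthonormal
  have h0 : ⟪hW.isHermitian.eigenvectorBasis i, hW.isHermitian.eigenvectorBasis j⟫_ℝ = 0 :=
    hon.2 hij
  have hn := hon.1 i
  have hn' := hon.1 j
  rw [ha] at hn
  rw [hb] at hn'
  rw [ha, hb, real_inner_smul_left, real_inner_smul_right] at h0
  have hz : a = 0 ∨ b = 0 ∨ onesVec m = 0 := by simpa using h0
  rcases hz with h | h | h <;> simp [h] at hn hn'

lemma IsWeightMatrix.lambda2_nonneg (hm : 2 ≤ m) (hW : IsWeightMatrix G W) :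
    0 ≤ lambda2 hm hW.isHermitian := by
  have := hW.eigenvalues_nonneg ((Fintype.equivOfCardEq (Fintype.card_fin _))
    (⟨1, by rw [Fintype.card_fin]; omega⟩ : Fin (Fintype.card (Fin m))))
  simpa [Matrix.IsHermitian.eigenvalues, lambda2] using this

lemma IsWeightMatrix.lambda2_lt_one (hm : 2 ≤ m) (hW : IsWeightMatrix G W) :
    lambda2 hm hW.isHermitian < 1 := by
  by_contra! h
  let e : Fin (Fintype.card (Fin m)) ≃ Fin m := Fintype.equivOfCardEq (Fintype.card_fin _)
  have he : ∀ k, hW.isHermitian.eigenvalues (e k) = hW.isHermitian.eigenvalues₀ k := by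
    intro k; simp [Matrix.IsHermitian.eigenvalues, e]
  let k0 : Fin (Fintype.card (Fin m)) := ⟨0, by rw [Fintype.card_fin]; omega⟩
  let k1 : Fin (Fintype.card (Fin m)) := ⟨1, by rw [Fintype.card_fin]; omega⟩
  have h1 : hW.isHermitian.eigenvalues (e k1) = 1 :=
    le_antisymm (hW.eigenvalues_le_one _) (by rw [he]; exact h)
  have h0 : hW.isHermitian.eigenvalues (e k0) = 1 := by
    refine le_antisymm (hW.eigenvalues_le_one _) ?_
    rw [← h1, he, he]
    exact hW.isHermitian.eigenvalues₀_antitone (by simp [k0, k1, Fin.le_def])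
  have := e.injective (hW.eq_of_eigenvalues_eq_one h0 h1)
  simp [k0, k1] at this

lemma IsWeightMatrix.eigenvalues_le_lambda2 (hm : 2 ≤ m) (hW : IsWeightMatrix G W) {i : Fin m}
    (hi : hW.isHermitian.eigenvalues i ≠ 1) :
    hW.isHermitian.eigenvalues i ≤ lambda2 hm hW.isHermitian := by
  let e : Fin (Fintype.card (Fin m)) ≃ Fin m := Fintype.equivOfCardEq (Fintype.card_fin _)
  have he : ∀ k, hW.isHermitian.eigenvalues (e k) = hW.isHermitian.eigenvalues₀ k := by
    intro k; simp [Matrix.IsHermitian.eigenvalues, e]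
  have hex : ∃ j, hW.isHermitian.eigenvalues j = 1 := by
    by_contra! hne
    have horth : onesVec m = 0 := by
      refine InnerProductSpace.ext_inner_left_basis (𝕜 := ℝ)
        hW.isHermitian.eigenvectorBasis.toBasis fun j => ?_
      simpa [PiLp.inner_apply, onesVec] using hW.sum_eigenvector (hne j)
    have := congrArg (fun v : EuclideanSpace ℝ (Fin m) => v ⟨0, by omega⟩) horth
    simp [onesVec] at this
  obtain ⟨j, hj⟩ := hex
  obtain ⟨k, rfl⟩ := e.surjective i
  rcases Nat.eq_zero_or_pos k.val with hk | hk
  · obtain ⟨l, rfl⟩ := e.surjective j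
    exfalso
    apply hi
    refine le_antisymm (hW.eigenvalues_le_one _) ?_
    rw [← hj, he, he]
    exact hW.isHermitian.eigenvalues₀_antitone (by rw [Fin.le_def]; omega)
  · rw [he]
    exact hW.isHermitian.eigenvalues₀_antitone (by rw [Fin.le_def]; exact hk)

lemma IsWeightMatrix.frobSq_dev_fastMix_le (hm : 2 ≤ m) (hW : IsWeightMatrix G W) {K : ℕ}
    (hK : 15 / √(1 - lambda2 hm hW.isHermitian) ≤ (K : ℝ)) (x : Rows m d) :
    frobSq (dev (fastMix W (mixParam (lambda2 hm hW.isHermitian)) K x))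
      ≤ 1 / 10000 * frobSq (dev x) := by
  rw [← sum_norm_coef_sq hW.isHermitian.eigenvectorBasis,
    ← sum_norm_coef_sq hW.isHermitian.eigenvectorBasis, Finset.mul_sum]
  refine Finset.sum_le_sum fun i _ => ?_
  by_cases hi : hW.isHermitian.eigenvalues i = 1
  · obtain ⟨c, hc⟩ := hW.eigenvector_of_eq_one hi
    have h0 : ∀ y : Rows m d, coef (hW.isHermitian.eigenvectorBasis i) (dev y) = 0 := by
      intro y
      have := sum_dev (by omega) y
      simp [hc, coef, onesVec, ← Finset.smul_sum, this]
    simp [h0]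
  · have h0 : ∀ y : Rows m d, coef (hW.isHermitian.eigenvectorBasis i) (dev y)
        = coef (hW.isHermitian.eigenvectorBasis i) y := by
      intro y
      simp [coef, dev, ones, smul_sub, Finset.sum_sub_distrib, ← Finset.sum_smul,
        hW.sum_eigenvector hi]
    have hmix := mixPoly_sq_le (hW.lambda2_lt_one hm) (hW.eigenvalues_nonneg i)
      (hW.eigenvalues_le_lambda2 hm hi) K
    have hpow := mixParam_pow_le (hW.lambda2_nonneg hm) (hW.lambda2_lt_one hm) hK
    rw [h0, h0, fastMix, coef_fastMixSeq hW.isHermitian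
      (hW.isHermitian.mulVec_eigenvectorBasis i), norm_smul, mul_pow, Real.norm_eq_abs, sq_abs]
    gcongr
    norm_num at hpow ⊢
    linarith

end FastMix

section Convexity

variable {E : Type*} [NormedAddCommGroup E] [InnerProductSpace ℝ E]

/-- Quadratic growth of a strongly convex function around a minimizer. -/
lemma quadratic_growth {c : ℝ} {h : E → ℝ} (hh : StrongConvexOn Set.univ c h) {w : E}
    (hw : IsMinOn h Set.univ w) (u : E) : h w + c / 2 * ‖u - w‖ ^ 2 ≤ h u := by
  have key : ∀ t ∈ Set.Ioo (0 : ℝ) 1, h w + (1 - t) * (c / 2 * ‖u - w‖ ^ 2) ≤ h u := by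
    intro t ht
    have h1 := hh.2 (Set.mem_univ u) (Set.mem_univ w) ht.1.le (sub_nonneg.2 ht.2.le)
      (by ring)
    have h2 := isMinOn_iff.1 hw (t • u + (1 - t) • w) (Set.mem_univ _)
    simp only [smul_eq_mul] at h1
    have h3 : t * (h w + (1 - t) * (c / 2 * ‖u - w‖ ^ 2)) ≤ t * h u := by linarith
    exact le_of_mul_le_mul_left h3 ht.1
  have hlim : Filter.Tendsto (fun t : ℝ => h w + (1 - t) * (c / 2 * ‖u - w‖ ^ 2))
      (nhdsWithin 0 (Set.Ioi 0)) (nhds (h w + (1 - 0) * (c / 2 * ‖u - w‖ ^ 2))) :=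
    (Continuous.tendsto (by fun_prop) 0).mono_left nhdsWithin_le_nhds
  have := le_of_tendsto hlim (Filter.eventually_of_mem (Ioo_mem_nhdsGT one_pos) key)
  simpa using this

/-- A strongly convex function on a finite-dimensional space has a minimizer. -/
lemma exists_isMinOn [FiniteDimensional ℝ E] {c : ℝ} (hc : 0 < c) {h : E → ℝ}
    (hh : StrongConvexOn Set.univ c h) : ∃ w, IsMinOn h Set.univ w := by
  have : ProperSpace E := FiniteDimensional.proper_real E
  have hcont : Continuous h := by
    rw [← continuousOn_univ]
    exact (UniformConvexOn.convexOn hh (fun r => by positivity)).continuousOn isOpen_univ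
  obtain ⟨a, -, ha⟩ := (isCompact_closedBall (0 : E) 1).exists_isMinOn
    ⟨0, by simp⟩ hcont.continuousOn
  have ha' : ∀ v : E, ‖v‖ ≤ 1 → h a ≤ h v := fun v hv =>
    isMinOn_iff.1 ha v (by simpa using hv)
  -- outside a large ball the values exceed `h 0`
  set R : ℝ := 1 + 2 / c * (h 0 - h a) with hR
  have h0a : 0 ≤ h 0 - h a := sub_nonneg.2 (ha' 0 (by simp))
  have hR1 : 1 ≤ R := by rw [hR]; linarith [show 0 ≤ 2 / c * (h 0 - h a) by positivity]
  have hout : ∀ v : E, R ^ 2 < ‖v‖ → h 0 ≤ h v := by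
    intro v hv
    set r := ‖v‖ with hr
    have hr1 : 1 < r := by nlinarith
    have hr0 : 0 < r := by linarith
    have h1 := hh.2 (Set.mem_univ v) (Set.mem_univ 0)
      (show 0 ≤ 1 / r by positivity)
      (show 0 ≤ 1 - 1 / r from sub_nonneg.2 (by rw [div_le_one hr0]; exact hr1.le)) (by ring)
    simp only [smul_eq_mul, smul_zero, add_zero, sub_zero, ← hr] at h1
    have h2 := ha' ((1 / r) • v) (by
      rw [norm_smul, Real.norm_eq_abs, abs_of_pos (by positivity), ← hr,
        one_div_mul_cancel hr0.ne'])
    have h3 : h a ≤ 1 / r * h v + (1 - 1 / r) * h 0 - (1 / r) * (1 - 1 / r) * (c / 2 * r ^ 2) :=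
      h2.trans h1
    have h4 : r * h a ≤ h v + (r - 1) * h 0 - (r - 1) * (c / 2 * r) := by
      have := mul_le_mul_of_nonneg_left h3 hr0.le
      have e : r * (1 / r * h v + (1 - 1 / r) * h 0 - (1 / r) * (1 - 1 / r) * (c / 2 * r ^ 2))
          = h v + (r - 1) * h 0 - (r - 1) * (c / 2 * r) := by field_simp
      linarith
    have hRc : c / 2 * (R - 1) = h 0 - h a := by rw [hR]; field_simp; ring
    have h5 : h 0 - h a ≤ c / 2 * (r - 1) := by
      rw [← hRc]; gcongr; nlinarith
    have h6 : r * (h 0 - h a) ≤ r * (c / 2 * (r - 1)) := by gcongr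
    linarith
  obtain ⟨w, -, hw⟩ := (isCompact_closedBall (0 : E) (R ^ 2)).exists_isMinOn
    ⟨0, by simp; positivity⟩ hcont.continuousOn
  refine ⟨w, isMinOn_iff.2 fun v _ => ?_⟩
  rcases le_or_gt ‖v‖ (R ^ 2) with hv | hv
  · exact isMinOn_iff.1 hw v (by simpa using hv)
  · exact (isMinOn_iff.1 hw 0 (by simp; positivity)).trans (hout v hv)

lemma strongConvexOn_prox {μ γ : ℝ} (hγ : 0 ≤ γ) {g : E → ℝ}
    (hg : StrongConvexOn Set.univ μ g) (v : E) :
    StrongConvexOn Set.univ (γ * μ + 1) fun u => γ * g u + 1 / 2 * ‖u - v‖ ^ 2 := by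
  refine ⟨convex_univ, fun x _ y _ a b ha hb hab => ?_⟩
  have h1 := hg.2 (Set.mem_univ x) (Set.mem_univ y) ha hb hab
  have h2 : ‖a • x + b • y - v‖ ^ 2
      = a * ‖x - v‖ ^ 2 + b * ‖y - v‖ ^ 2 - a * b * ‖x - y‖ ^ 2 := by
    obtain rfl : b = 1 - a := by linarith
    have e1 : a • x + (1 - a) • y - v = a • (x - v) + (1 - a) • (y - v) := by
      simp only [smul_sub, sub_smul, one_smul]; abel
    have e2 : x - y = (x - v) - (y - v) := by abel
    rw [e1, e2]
    generalize x - v = p, y - v = q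
    rw [norm_add_sq_real, norm_sub_sq_real p q, norm_smul, norm_smul, mul_pow, mul_pow,
      Real.norm_eq_abs, Real.norm_eq_abs, sq_abs, sq_abs, real_inner_smul_left,
      real_inner_smul_right]
    ring
  have h3 := mul_le_mul_of_nonneg_left h1 hγ
  simp only [smul_eq_mul] at h3 ⊢
  rw [h2]
  linarith

end Convexity

section Smooth

variable {m d : ℕ}

/-- The three-point inequality of the proximal operator. -/
lemma prox_three_point {μ γ : ℝ} (hμ : 0 ≤ μ) (hγ : 0 ≤ γ) {g : Vec d → ℝ}
    (hg : StrongConvexOn Set.univ μ g) (z s u : Vec d) :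
    γ * g (prox γ g (z - γ • s)) + γ * ⟪s, prox γ g (z - γ • s) - u⟫_ℝ
        + 1 / 2 * ‖prox γ g (z - γ • s) - z‖ ^ 2
        + (1 + γ * μ) / 2 * ‖prox γ g (z - γ • s) - u‖ ^ 2
      ≤ γ * g u + 1 / 2 * ‖z - u‖ ^ 2 := by
  have hsc := strongConvexOn_prox hγ hg (z - γ • s)
  have hmin : IsMinOn (fun u => γ * g u + 1 / 2 * ‖u - (z - γ • s)‖ ^ 2) Set.univ
      (prox γ g (z - γ • s)) :=
    Classical.epsilon_spec (exists_isMinOn (by positivity) hsc)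
  have h := quadratic_growth hsc hmin u
  generalize prox γ g (z - γ • s) = w at h ⊢
  have e : ∀ p : Vec d, ‖p - (z - γ • s)‖ ^ 2
      = ‖p - z‖ ^ 2 + 2 * γ * ⟪s, p - z⟫_ℝ + ‖γ • s‖ ^ 2 := by
    intro p
    rw [show p - (z - γ • s) = (p - z) + γ • s by abel, norm_add_sq_real, real_inner_smul_right,
      real_inner_comm]
    ring
  simp only [e] at h
  have e2 : ⟪s, w - u⟫_ℝ = ⟪s, w - z⟫_ℝ - ⟪s, u - z⟫_ℝ := by
    rw [← inner_sub_right]; congr 1; abel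
  rw [e2, norm_sub_rev z u, norm_sub_rev w u]
  linarith

variable {L : ℝ} {f : Vec d → ℝ}

lemma IsConvexSmooth.cocoercive (hf : IsConvexSmooth L f) (hL : 0 < L) (x y : Vec d) :
    f x + ⟪∇ f x, y - x⟫_ℝ + 1 / (2 * L) * ‖∇ f y - ∇ f x‖ ^ 2 ≤ f y := by
  set q := ∇ f y - ∇ f x with hq
  have h1 := hf.upper y (y - (1 / L) • q)
  have h2 := hf.lower x (y - (1 / L) • q)
  have e1 : y - (1 / L) • q - y = -((1 / L) • q) := by abel
  have e2 : y - (1 / L) • q - x = (y - x) - (1 / L) • q := by abel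
  have e3 : y - (y - (1 / L) • q) = (1 / L) • q := by abel
  rw [e1, e3, inner_neg_right, real_inner_smul_right, norm_smul, mul_pow, Real.norm_eq_abs,
    sq_abs] at h1
  rw [e2, inner_sub_right, real_inner_smul_right] at h2
  have e4 : ⟪∇ f y, q⟫_ℝ - ⟪∇ f x, q⟫_ℝ = ‖q‖ ^ 2 := by
    rw [← inner_sub_left, ← hq, real_inner_self_eq_norm_sq]
  have e5 : 1 / L * ⟪∇ f y, q⟫_ℝ - 1 / L * ⟪∇ f x, q⟫_ℝ = 1 / L * ‖q‖ ^ 2 := by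
    rw [← e4]; ring
  have e6 : L / 2 * ((1 / L) ^ 2 * ‖q‖ ^ 2) = 1 / (2 * L) * ‖q‖ ^ 2 := by
    field_simp
  have e7 : 1 / L * ‖q‖ ^ 2 = 2 * (1 / (2 * L) * ‖q‖ ^ 2) := by field_simp
  linarith

lemma IsConvexSmooth.norm_gradient_sub_sq_le (hf : IsConvexSmooth L f) (hL : 0 < L)
    (x y : Vec d) : ‖∇ f y - ∇ f x‖ ^ 2 ≤ L ^ 2 * ‖y - x‖ ^ 2 := by
  have h1 := hf.cocoercive hL x y
  have h2 := hf.upper x y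
  rw [norm_sub_rev x y] at h2
  have h3 : 1 / (2 * L) * ‖∇ f y - ∇ f x‖ ^ 2 ≤ L / 2 * ‖y - x‖ ^ 2 := by linarith
  have h4 := mul_le_mul_of_nonneg_left h3 (by positivity : 0 ≤ 2 * L)
  have e1 : 2 * L * (1 / (2 * L) * ‖∇ f y - ∇ f x‖ ^ 2) = ‖∇ f y - ∇ f x‖ ^ 2 := by field_simp
  have e2 : 2 * L * (L / 2 * ‖y - x‖ ^ 2) = L ^ 2 * ‖y - x‖ ^ 2 := by ring
  linarith

lemma IsConvexSmooth.le_convexComb (hf : IsConvexSmooth L f) {a b : ℝ} (ha : 0 ≤ a)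
    (hb : 0 ≤ b) (hab : a + b = 1) (x y : Vec d) :
    f (a • x + b • y) ≤ a * f x + b * f y := by
  set p := a • x + b • y with hp
  have h1 := mul_le_mul_of_nonneg_left (hf.lower p x) ha
  have h2 := mul_le_mul_of_nonneg_left (hf.lower p y) hb
  have h3 : a * ⟪∇ f p, x - p⟫_ℝ + b * ⟪∇ f p, y - p⟫_ℝ = 0 := by
    rw [← real_inner_smul_right, ← real_inner_smul_right, ← inner_add_right]
    have : a • (x - p) + b • (y - p) = (0 : Vec d) := by
      have : a • (x - p) + b • (y - p) = p - (a + b) • p := by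
        rw [hp]; module
      rw [this, hab, one_smul, sub_self]
    rw [this, inner_zero_right]
  have h4 : f p = a * f p + b * f p := by rw [← add_mul, hab, one_mul]
  linarith

lemma strongConvexOn_objective {μ : ℝ} {f : Fin m → Vec d → ℝ}
    (hf : ∀ i, IsConvexSmooth L (f i)) {g : Vec d → ℝ} (hg : StrongConvexOn Set.univ μ g) :
    StrongConvexOn Set.univ μ (objective f g) := by
  refine ⟨convex_univ, fun x _ y _ a b ha hb hab => ?_⟩
  have h1 := hg.2 (Set.mem_univ x) (Set.mem_univ y) ha hb hab
  have h2 : ∑ i, f i (a • x + b • y) ≤ a * ∑ i, f i x + b * ∑ i, f i y := by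
    rw [Finset.mul_sum, Finset.mul_sum, ← Finset.sum_add_distrib]
    exact Finset.sum_le_sum fun i _ => (hf i).le_convexComb ha hb hab x y
  have h3 := mul_le_mul_of_nonneg_left h2 (by positivity : (0 : ℝ) ≤ 1 / m)
  simp only [smul_eq_mul, objective] at h1 ⊢
  linarith

end Smooth

section Descent

variable {m d : ℕ}

lemma sum_objective_eq (hm : m ≠ 0) (f : Fin m → Vec d → ℝ) (g : Vec d → ℝ) (u : Vec d) :
    m * objective f g u = ∑ i, f i u + m * g u := by
  have : (m : ℝ) ≠ 0 := by exact_mod_cast hm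
  rw [objective]; field_simp

lemma map_avg_le (hm : m ≠ 0) {g : Vec d → ℝ} (hg : ConvexOn ℝ Set.univ g) (w : Rows m d) :
    m * g (avg w) ≤ ∑ i, g (w i) := by
  have hm' : (0 : ℝ) < m := by exact_mod_cast Nat.pos_of_ne_zero hm
  have h := hg.map_sum_le (t := Finset.univ) (w := fun _ : Fin m => 1 / (m : ℝ)) (p := w)
    (fun _ _ => by positivity) (by simp [hm'.ne']) (fun _ _ => Set.mem_univ _)
  rw [← Finset.smul_sum, ← Finset.smul_sum, smul_eq_mul] at h
  rw [avg]
  have := mul_le_mul_of_nonneg_left h hm'.le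
  rwa [← mul_assoc, mul_one_div_cancel hm'.ne', one_mul] at this

/-- The sum of the linearizations of the `fᵢ` at the rows of `x`, evaluated at `u`. -/
def linearization (f : Fin m → Vec d → ℝ) (x : Rows m d) (u : Vec d) : ℝ :=
  ∑ i, (f i (x i) + ⟪∇ (f i) (x i), u - x i⟫_ℝ)

lemma linearization_sub (hm : m ≠ 0) (f : Fin m → Vec d → ℝ) (x : Rows m d) (u v : Vec d) :
    linearization f x u - linearization f x v = m * ⟪avg (gradRows f x), u - v⟫_ℝ := by
  have h : ∀ i, (f i (x i) + ⟪∇ (f i) (x i), u - x i⟫_ℝ) - (f i (x i) + ⟪∇ (f i) (x i), v - x i⟫_ℝ)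
      = ⟪gradRows f x i, u - v⟫_ℝ := by
    intro i
    rw [add_sub_add_left_eq_sub, ← inner_sub_right, sub_sub_sub_cancel_right, gradRows]
  rw [linearization, linearization, ← Finset.sum_sub_distrib]
  simp only [h]
  rw [← sum_inner, sum_rows hm, real_inner_smul_left]

variable {L : ℝ} {f : Fin m → Vec d → ℝ}

lemma linearization_le (hf : ∀ i, IsConvexSmooth L (f i)) (hL : 0 < L) (x : Rows m d)
    (u : Vec d) :
    linearization f x u + 1 / (2 * L) * frobSq (gradRows f x - gradRows f (ones u))
      ≤ ∑ i, f i u := by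
  rw [linearization, frobSq_eq, Finset.mul_sum, ← Finset.sum_add_distrib]
  refine Finset.sum_le_sum fun i _ => ?_
  have := (hf i).cocoercive hL (x i) u
  rwa [norm_sub_rev] at this

lemma le_linearization (hm : m ≠ 0) (hf : ∀ i, IsConvexSmooth L (f i)) (x : Rows m d)
    (u : Vec d) :
    ∑ i, f i u ≤ linearization f x u + L / 2 * (frobSq (dev x) + m * ‖avg x - u‖ ^ 2) := by
  rw [← frobSq_sub_ones hm, linearization, frobSq_eq, Finset.mul_sum, ← Finset.sum_add_distrib]
  exact Finset.sum_le_sum fun i _ => (hf i).upper (x i) u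

lemma frobSq_gradRows_sub_le (hf : ∀ i, IsConvexSmooth L (f i)) (hL : 0 < L) (x y : Rows m d) :
    frobSq (gradRows f y - gradRows f x) ≤ L ^ 2 * frobSq (y - x) := by
  rw [frobSq_eq, frobSq_eq, Finset.mul_sum]
  exact Finset.sum_le_sum fun i _ => (hf i).norm_gradient_sub_sq_le hL (x i) (y i)

lemma sum_prox_three_point (hm : m ≠ 0) {μ γ : ℝ} (hμ : 0 ≤ μ) (hγ : 0 ≤ γ) {g : Vec d → ℝ}
    (hg : StrongConvexOn Set.univ μ g) (z s : Rows m d) (u : Vec d) :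
    γ * (m * g (avg (proxRows γ g (z - γ • s))))
        + γ * (m * ⟪avg s, avg (proxRows γ g (z - γ • s)) - u⟫_ℝ)
        + γ * ∑ i, ⟪dev s i, dev (proxRows γ g (z - γ • s)) i⟫_ℝ
        + 1 / 2 * (m * ‖avg (proxRows γ g (z - γ • s)) - avg z‖ ^ 2)
        + (1 + γ * μ) / 2 * frobSq (proxRows γ g (z - γ • s) - ones u)
      ≤ γ * (m * g u) + 1 / 2 * frobSq (z - ones u) := by
  have h1 : ∀ i : Fin m, γ * g (proxRows γ g (z - γ • s) i)
      + γ * ⟪s i, (proxRows γ g (z - γ • s) - ones u : Rows m d) i⟫_ℝ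
      + 1 / 2 * ‖(proxRows γ g (z - γ • s) - z) i‖ ^ 2
      + (1 + γ * μ) / 2 * ‖(proxRows γ g (z - γ • s) - ones u : Rows m d) i‖ ^ 2
      ≤ γ * g u + 1 / 2 * ‖(z - ones u : Rows m d) i‖ ^ 2 := fun i =>
    prox_three_point hμ hγ hg (z i) (s i) u
  generalize proxRows γ g (z - γ • s) = w at h1 ⊢
  have h2 := Finset.sum_le_sum fun i (_ : i ∈ Finset.univ) => h1 i
  simp only [Finset.sum_add_distrib, ← Finset.mul_sum, ← frobSq_eq, Finset.sum_const,
    Finset.card_univ, Fintype.card_fin, nsmul_eq_mul] at h2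
  rw [sum_inner_rows hm, dev_sub, dev_ones hm, sub_zero, avg_sub, avg_ones hm] at h2
  have h3 : m * ‖avg w - avg z‖ ^ 2 ≤ frobSq (w - z) := by
    have h := frobSq_sub_ones hm (w - z) 0
    have e : w - z - ones 0 = w - z := by ext1 i; simp [ones]
    rw [e, avg_sub, sub_zero] at h
    linarith [frobSq_nonneg (dev (w - z))]
  have h4 := mul_le_mul_of_nonneg_left
    (map_avg_le hm (UniformConvexOn.convexOn hg fun r => by positivity) w) hγ
  linarith

/-- The estimate of one accelerated proximal step with inexact gradients. -/
lemma objective_descent (hm : m ≠ 0) {μ γ τ : ℝ} (hL : 0 < L) (hμ : 0 ≤ μ) (hγ : 0 ≤ γ)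
    (hτ : τ = μ * γ) (hτ1 : τ ≤ 1) (hf : ∀ i, IsConvexSmooth L (f i)) {g : Vec d → ℝ}
    (hg : StrongConvexOn Set.univ μ g) (x y z s w : Rows m d)
    (hs : avg s = avg (gradRows f x)) (hw : w = proxRows γ g (z - γ • s)) (u : Vec d) :
    m * objective f g (τ • avg w + (1 - τ) • avg y) - m * objective f g u ≤
      (1 - τ) * (m * objective f g (avg y) - m * objective f g u)
        - (1 - τ) * (1 / (2 * L) * frobSq (gradRows f x - gradRows f (ones (avg y))))
        + L / 2 * (frobSq (dev x) + m * ‖avg x - (τ • avg w + (1 - τ) • avg y)‖ ^ 2)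
        + μ / 2 * (frobSq (z - ones u) - (1 + τ) * frobSq (w - ones u)
          - m * ‖avg w - avg z‖ ^ 2)
        - μ * (γ * ∑ i, ⟪dev s i, dev w i⟫_ℝ) := by
  have hprox := sum_prox_three_point hm hμ hγ hg z s u
  rw [← hw, hs] at hprox
  have hτ0 : 0 ≤ τ := hτ ▸ mul_nonneg hμ hγ
  set p := τ • avg w + (1 - τ) • avg y with hp
  simp only [sum_objective_eq hm]
  have h1 := le_linearization hm hf x p
  have h2 := linearization_le hf hL x (avg y)
  have h3 := linearization_le hf hL x u
  have h3' : 0 ≤ 1 / (2 * L) * frobSq (gradRows f x - gradRows f (ones u)) := by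
    have := frobSq_nonneg (gradRows f x - gradRows f (ones u)); positivity
  have h4 := linearization_sub hm f x (avg w) u
  have h5 : linearization f x p
      = τ * linearization f x (avg w) + (1 - τ) * linearization f x (avg y) := by
    have e1 := linearization_sub hm f x p (avg y)
    have e2 := linearization_sub hm f x (avg w) (avg y)
    have e3 : p - avg y = τ • (avg w - avg y) := by rw [hp]; module
    rw [e3, real_inner_smul_right] at e1
    linear_combination e1 - τ * e2
  have h6 := hg.2 (Set.mem_univ (avg w)) (Set.mem_univ (avg y)) hτ0 (sub_nonneg.2 hτ1) (by ring)
  rw [← hp] at h6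
  have h7 : 0 ≤ τ * (1 - τ) * (μ / 2 * ‖avg w - avg y‖ ^ 2) := by
    have := sub_nonneg.2 hτ1; positivity
  simp only [smul_eq_mul] at h6
  have h8 : m * g p ≤ τ * (m * g (avg w)) + (1 - τ) * (m * g (avg y)) := by
    have : g p ≤ τ * g (avg w) + (1 - τ) * g (avg y) := by linarith
    have := mul_le_mul_of_nonneg_left this (Nat.cast_nonneg (α := ℝ) m)
    linarith
  have h9 := mul_le_mul_of_nonneg_left h2 (sub_nonneg.2 hτ1)
  have h10 : τ * linearization f x (avg w)
      ≤ τ * (∑ i, f i u + m * ⟪avg (gradRows f x), avg w - u⟫_ℝ) :=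
    mul_le_mul_of_nonneg_left (by linarith) hτ0
  have h11 := mul_le_mul_of_nonneg_left hprox hμ
  have h12 : τ * (m * g (avg w)) + τ * (m * ⟪avg (gradRows f x), avg w - u⟫_ℝ) - τ * (m * g u)
      ≤ μ / 2 * (frobSq (z - ones u) - (1 + τ) * frobSq (w - ones u) - m * ‖avg w - avg z‖ ^ 2)
        - μ * (γ * ∑ i, ⟪dev s i, dev w i⟫_ℝ) := by
    rw [hτ]
    linarith
  linarith

lemma neg_inner_rows_le (γ : ℝ) (s w : Rows m d) :
    -(2 * (γ * ∑ i, ⟪s i, w i⟫_ℝ)) ≤ 2 * (γ ^ 2 * frobSq s) + 1 / 2 * frobSq w := by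
  rw [frobSq_eq, frobSq_eq]
  simp only [Finset.mul_sum, ← Finset.sum_add_distrib, ← Finset.sum_neg_distrib]
  refine Finset.sum_le_sum fun i _ => ?_
  have h : 0 ≤ ‖(2 * γ) • s i + w i‖ ^ 2 := by positivity
  rw [norm_add_sq_real, norm_smul, mul_pow, Real.norm_eq_abs, sq_abs, real_inner_smul_left] at h
  linarith

end Descent

section Potential

variable {m d : ℕ}

lemma potential_arith {τ Φ Φ' Z Z' Wx b w zc zc' X X' Y Y' S S' E E' G H : ℝ}
    (hτ0 : 0 ≤ τ) (hτ : τ ≤ 1 / 20) (hΦ : 0 ≤ Φ) (hZ : 0 ≤ Z) (hw : 0 ≤ w) (hzc : 0 ≤ zc)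
    (hX : 0 ≤ X) (hY : 0 ≤ Y) (hS : 0 ≤ S) (hE : 0 ≤ E) (hE' : 0 ≤ E') (hG : 0 ≤ G)
    (hmain : Φ' + (1 + τ) * Wx ≤ (1 - τ) * Φ + Z - 399 / 400 * E' - (1 - τ) * (400 * G)
      + (2 * S' + 1 / 2 * w) + X' / 400)
    (hWx : Wx = w + b) (hZ' : Z' = zc' + b) (hzc' : zc' ≤ 1 / 10000 * w)
    (hX' : X' ≤ 2 * (zc + Y)) (hY' : Y' ≤ 1 / 10000 * (2 * (zc' + Y)))
    (hS' : S' ≤ 1 / 10000 * (3 * (S + G + H))) (hH : H ≤ (E + X) / 160000) :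
    Φ' + (1 + τ) * Z' + Y' / 50 + S' + X' / 400 + E' / 2 + zc' / 50 ≤
      (1 - 3 / 5 * τ) * (Φ + (1 + τ) * Z + Y / 50 + S + X / 400 + E / 2 + zc / 50) := by
  have h1 : 97 / 100 * (Y / 50 + S + X / 400 + E / 2 + zc / 50)
      ≤ (1 - 3 / 5 * τ) * (Y / 50 + S + X / 400 + E / 2 + zc / 50) := by
    gcongr; linarith
  have h2 : Z ≤ (1 - 3 / 5 * τ) * (1 + τ) * Z := le_mul_of_one_le_left hZ (by nlinarith)
  have h3 : (1 - τ) * Φ ≤ (1 - 3 / 5 * τ) * Φ := by gcongr; linarith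
  have h4 : 19 / 20 * (400 * G) ≤ (1 - τ) * (400 * G) := by gcongr; linarith
  have h5 : (1 + τ) * zc' ≤ (1 + τ) * (1 / 10000 * w) := by gcongr
  have h6 : 0 ≤ τ * w := mul_nonneg hτ0 hw
  subst hWx hZ'
  linarith

/-- The Lyapunov function of the algorithm. -/
def potential (f : Fin m → Vec d → ℝ) (g : Vec d → ℝ) (μ γ τ : ℝ) (u : Vec d) (S : State m d) :
    ℝ :=
  2 / μ * (m * objective f g (avg S.y) - m * objective f g u) + (1 + τ) * frobSq (S.z - ones u)
    + frobSq (dev S.y) / τ ^ 2 / 50 + γ ^ 2 * frobSq (dev S.s) + frobSq (dev S.x) / τ ^ 2 / 400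
    + m * ‖avg S.y - avg S.x‖ ^ 2 / τ ^ 2 / 2 + frobSq (dev S.z) / 50

/-- An averaging subroutine that preserves the mean and contracts the squared deviation from it
by the factor `1 / 10000`. -/
structure IsMixing (mix : Rows m d → Rows m d) : Prop where
  avg_eq : ∀ x, avg (mix x) = avg x
  dev_le : ∀ x, frobSq (dev (mix x)) ≤ 1 / 10000 * frobSq (dev x)

variable {mix : Rows m d → Rows m d} {f : Fin m → Vec d → ℝ} {g : Vec d → ℝ} {γ τ : ℝ}

/-- Gradient tracking. -/
lemma avg_step_s (hmix : IsMixing mix) (S : State m d) (hS : avg S.s = avg (gradRows f S.x)) :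
    avg (step f g mix γ τ S).s = avg (gradRows f (step f g mix γ τ S).x) := by
  simp only [step, hmix.avg_eq, avg_add, avg_sub, hS]
  abel

lemma potential_step_le (hm : m ≠ 0) (hmix : IsMixing mix) {L μ : ℝ} (hμ : 0 < μ) (hL : 0 < L)
    (hγ : 0 < γ) (hτ : τ = μ * γ) (hτ1 : τ ≤ 1 / 20) (hγ2 : 400 * (L * μ) * γ ^ 2 = 1)
    (hf : ∀ i, IsConvexSmooth L (f i)) (hg : StrongConvexOn Set.univ μ g) {u : Vec d}
    (hu : IsMinOn (objective f g) Set.univ u) (S : State m d)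
    (hS : avg S.s = avg (gradRows f S.x)) :
    potential f g μ γ τ u (step f g mix γ τ S)
      ≤ (1 - 3 / 5 * τ) * potential f g μ γ τ u S := by
  have hs' := avg_step_s (g := g) (γ := γ) (τ := τ) hmix S hS
  obtain ⟨x, y, z, s⟩ := S
  have hτ0 : 0 < τ := hτ ▸ mul_pos hμ hγ
  have hLτ : 400 * τ ^ 2 * L = μ := by rw [hτ]; linear_combination μ * hγ2
  simp only [step] at hs' ⊢
  set x' := τ • z + (1 - τ) • y with hx'
  set s' := mix (s + gradRows f x' - gradRows f x) with hs'def
  set w := proxRows γ g (z - γ • s') with hw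
  have hdesc := objective_descent hm hL hμ.le hγ.le hτ (by linarith) hf hg x' y z s' w hs' hw u
  have hyavg : avg (mix (τ • mix w + (1 - τ) • y)) = τ • avg w + (1 - τ) • avg y := by
    rw [hmix.avg_eq, avg_add, avg_smul, avg_smul, hmix.avg_eq]
  have hxavg : avg x' = τ • avg z + (1 - τ) • avg y := by
    rw [hx', avg_add, avg_smul, avg_smul]
  have hdiff : ‖τ • avg w + (1 - τ) • avg y - avg x'‖ ^ 2 = τ ^ 2 * ‖avg w - avg z‖ ^ 2 := by
    rw [hxavg, add_sub_add_right_eq_sub, ← smul_sub, norm_smul, mul_pow, Real.norm_eq_abs, sq_abs]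
  have hm0 : (0 : ℝ) ≤ m := Nat.cast_nonneg m
  have hH : γ ^ 2 * frobSq (gradRows f (ones (avg y)) - gradRows f x)
      ≤ (m * ‖avg y - avg x‖ ^ 2 / τ ^ 2 + frobSq (dev x) / τ ^ 2) / 160000 := by
    have h1 := frobSq_gradRows_sub_le hf hL x (ones (avg y))
    have h2 : frobSq (ones (avg y) - x) = frobSq (x - ones (avg y)) := by
      rw [← neg_sub, ← neg_one_smul ℝ, frobSq_smul]; norm_num
    rw [h2, frobSq_sub_ones hm, norm_sub_rev] at h1
    have h3 := mul_le_mul_of_nonneg_left h1 (sq_nonneg γ)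
    have h4 : γ ^ 2 * L ^ 2 = 1 / τ ^ 2 / 160000 := by
      have : (400 * (γ * L * τ)) ^ 2 = 1 := by
        rw [show 400 * (γ * L * τ) = 1 by rw [hτ]; linear_combination hγ2, one_pow]
      field_simp
      linear_combination this
    rw [← mul_assoc, h4] at h3
    refine h3.trans (le_of_eq ?_)
    ring
  have hS' : γ ^ 2 * frobSq (dev s') ≤ 1 / 10000 * (3 * (γ ^ 2 * frobSq (dev s)
      + γ ^ 2 * frobSq (gradRows f x' - gradRows f (ones (avg y)))
      + γ ^ 2 * frobSq (gradRows f (ones (avg y)) - gradRows f x))) := by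
    have e : s + gradRows f x' - gradRows f x = s + (gradRows f x' - gradRows f (ones (avg y)))
        + (gradRows f (ones (avg y)) - gradRows f x) := by abel
    have h1 := hmix.dev_le (s + gradRows f x' - gradRows f x)
    rw [← hs'def, e, dev_add, dev_add] at h1
    have h2 := frobSq_add_three_le (dev s) (dev (gradRows f x' - gradRows f (ones (avg y))))
      (dev (gradRows f (ones (avg y)) - gradRows f x))
    have h3 := frobSq_dev_le hm (gradRows f x' - gradRows f (ones (avg y)))
    have h4 := frobSq_dev_le hm (gradRows f (ones (avg y)) - gradRows f x)
    have h5 : frobSq (dev s') ≤ 1 / 10000 * (3 * (frobSq (dev s)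
      + frobSq (gradRows f x' - gradRows f (ones (avg y)))
      + frobSq (gradRows f (ones (avg y)) - gradRows f x))) := by linarith
    have := mul_le_mul_of_nonneg_left h5 (sq_nonneg γ)
    linarith
  have hcomb : ∀ p q : Rows m d,
      frobSq (dev (τ • p + (1 - τ) • q)) / τ ^ 2 ≤ 2 * (frobSq (dev p) + frobSq (dev q) / τ ^ 2) := by
    intro p q
    have h1 := frobSq_add_le (τ • dev p) ((1 - τ) • dev q)
    rw [frobSq_smul, frobSq_smul] at h1
    have h2 : (1 - τ) ^ 2 * frobSq (dev q) ≤ 1 * frobSq (dev q) :=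
      mul_le_mul_of_nonneg_right (by nlinarith) (frobSq_nonneg _)
    rw [dev_add, dev_smul, dev_smul, div_le_iff₀ (by positivity)]
    calc _ ≤ _ := h1
      _ ≤ 2 * (τ ^ 2 * frobSq (dev p) + 1 * frobSq (dev q)) := by linarith
      _ = _ := by field_simp
  have hY' : frobSq (dev (mix (τ • mix w + (1 - τ) • y))) / τ ^ 2
      ≤ 1 / 10000 * (2 * (frobSq (dev (mix w)) + frobSq (dev y) / τ ^ 2)) := by
    refine le_trans ?_ (mul_le_mul_of_nonneg_left (hcomb (mix w) y) (by norm_num))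
    rw [← mul_div_assoc]
    gcongr
    exact hmix.dev_le _
  have hmain : 2 / μ * (m * objective f g (τ • avg w + (1 - τ) • avg y) - m * objective f g u)
      + (1 + τ) * frobSq (w - ones u) ≤
      (1 - τ) * (2 / μ * (m * objective f g (avg y) - m * objective f g u)) + frobSq (z - ones u)
      - 399 / 400 * (m * ‖avg w - avg z‖ ^ 2)
      - (1 - τ) * (400 * (γ ^ 2 * frobSq (gradRows f x' - gradRows f (ones (avg y)))))
      + (2 * (γ ^ 2 * frobSq (dev s')) + 1 / 2 * frobSq (dev w))
      + frobSq (dev x') / τ ^ 2 / 400 := by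
    have h1 := mul_le_mul_of_nonneg_left hdesc (by positivity : 0 ≤ 2 / μ)
    have h2 := neg_inner_rows_le γ (dev s') (dev w)
    rw [norm_sub_rev (avg x'), hdiff] at h1
    have e1 : 2 / μ * (1 / (2 * L)) = 400 * γ ^ 2 := by
      field_simp; linear_combination -hγ2
    have e2 : 2 / μ * (L / 2) = 1 / τ ^ 2 / 400 := by
      field_simp; linear_combination hLτ
    have e3 : 2 / μ * (μ / 2) = 1 := by field_simp
    have e4 : 2 / μ * μ = 2 := by field_simp
    have e5 : 1 / τ ^ 2 / 400 * (τ ^ 2) = 1 / 400 := by field_simp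
    set A := frobSq (gradRows f x' - gradRows f (ones (avg y)))
    set B := m * ‖avg w - avg z‖ ^ 2 with hB
    have e6 : 2 / μ * ((1 - τ) * (m * objective f g (avg y) - m * objective f g u)
        - (1 - τ) * (1 / (2 * L) * A)
        + L / 2 * (frobSq (dev x') + m * (τ ^ 2 * ‖avg w - avg z‖ ^ 2))
        + μ / 2 * (frobSq (z - ones u) - (1 + τ) * frobSq (w - ones u) - B)
        - μ * (γ * ∑ i, ⟪dev s' i, dev w i⟫_ℝ))
        = (1 - τ) * (2 / μ * (m * objective f g (avg y) - m * objective f g u))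
          - (1 - τ) * (400 * (γ ^ 2 * A)) + frobSq (dev x') / τ ^ 2 / 400 + 1 / 400 * B
          + (frobSq (z - ones u) - (1 + τ) * frobSq (w - ones u) - B)
          - 2 * (γ * ∑ i, ⟪dev s' i, dev w i⟫_ℝ) := by
      rw [hB]
      linear_combination (-(1 - τ) * A) * e1 + (frobSq (dev x')
        + m * (τ ^ 2 * ‖avg w - avg z‖ ^ 2)) * e2
        + (frobSq (z - ones u) - (1 + τ) * frobSq (w - ones u) - m * ‖avg w - avg z‖ ^ 2) * e3
        - (γ * ∑ i, ⟪dev s' i, dev w i⟫_ℝ) * e4 + (m * ‖avg w - avg z‖ ^ 2) * e5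
    rw [e6] at h1
    linarith
  have hΦ : 0 ≤ 2 / μ * (m * objective f g (avg y) - m * objective f g u) := by
    have := isMinOn_iff.1 hu (avg y) (Set.mem_univ _)
    rw [← mul_sub]
    have := sub_nonneg.2 this
    positivity
  have hE' : m * ‖τ • avg w + (1 - τ) • avg y - avg x'‖ ^ 2 / τ ^ 2 = m * ‖avg w - avg z‖ ^ 2 := by
    rw [hdiff]; field_simp
  simp only [potential, hyavg, hE']
  have hdiv : ∀ p : Rows m d, 0 ≤ frobSq (dev p) / τ ^ 2 := fun p =>
    div_nonneg (frobSq_nonneg _) (sq_nonneg _)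
  have hZ' := frobSq_sub_ones hm (mix w) u
  rw [hmix.avg_eq] at hZ'
  exact potential_arith hτ0.le hτ1 hΦ (frobSq_nonneg _) (frobSq_nonneg _) (frobSq_nonneg _)
    (hdiv x) (hdiv y) (mul_nonneg (sq_nonneg _) (frobSq_nonneg _)) (by positivity) (by positivity)
    (mul_nonneg (sq_nonneg _) (frobSq_nonneg _)) hmain (frobSq_sub_ones hm w u) hZ'
    (hmix.dev_le w) (hcomb z y) hY' hS' hH

end Potential

section Convergence

variable {m d : ℕ}

lemma IsWeightMatrix.isMixing (hm : 2 ≤ m) {G : SimpleGraph (Fin m)}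
    {W : Matrix (Fin m) (Fin m) ℝ} (hW : IsWeightMatrix G W) {K : ℕ}
    (hK : 15 / √(1 - lambda2 hm hW.isHermitian) ≤ (K : ℝ)) :
    IsMixing (d := d) (fastMix W (mixParam (lambda2 hm hW.isHermitian)) K) :=
  ⟨hW.avg_fastMix _ K, hW.frobSq_dev_fastMix_le hm hK⟩

variable {mix : Rows m d → Rows m d} {f : Fin m → Vec d → ℝ} {g : Vec d → ℝ} {γ τ : ℝ}

lemma avg_iterate_s (hmix : IsMixing mix) (x₁ : Vec d) (t : ℕ) :
    avg (iterate f g mix γ τ x₁ (t + 1)).s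
      = avg (gradRows f (iterate f g mix γ τ x₁ (t + 1)).x) := by
  induction t with
  | zero => rfl
  | succ t ih => exact avg_step_s hmix _ ih

/-- Linear convergence of the Lyapunov function. -/
lemma potential_iterate_le (hm : m ≠ 0) (hmix : IsMixing mix) {L μ : ℝ} (hμ : 0 < μ) (hL : 0 < L)
    (hγ : 0 < γ) (hτ : τ = μ * γ) (hτ1 : τ ≤ 1 / 20) (hγ2 : 400 * (L * μ) * γ ^ 2 = 1)
    (hf : ∀ i, IsConvexSmooth L (f i)) (hg : StrongConvexOn Set.univ μ g) {u : Vec d}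
    (hu : IsMinOn (objective f g) Set.univ u) (x₁ : Vec d) (t : ℕ) :
    potential f g μ γ τ u (iterate f g mix γ τ x₁ (t + 1))
      ≤ (1 - 3 / 5 * τ) ^ t * potential f g μ γ τ u (initState f x₁) := by
  induction t with
  | zero => simp [iterate]
  | succ t ih =>
    have h1 := potential_step_le hm hmix hμ hL hγ hτ hτ1 hγ2 hf hg hu _
      (avg_iterate_s (g := g) (γ := γ) (τ := τ) (f := f) hmix x₁ t)
    rw [pow_succ']
    refine le_trans h1 ?_
    rw [mul_assoc]
    exact mul_le_mul_of_nonneg_left ih (by linarith)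

lemma frobSq_z_le_potential {μ : ℝ} (hμ : 0 < μ) {u : Vec d}
    (hu : IsMinOn (objective f g) Set.univ u) (S : State m d) :
    (1 + τ) * frobSq (S.z - ones u) ≤ potential f g μ γ τ u S := by
  have hΦ : 0 ≤ 2 / μ * (m * objective f g (avg S.y) - m * objective f g u) := by
    rw [← mul_sub]
    have := sub_nonneg.2 (isMinOn_iff.1 hu (avg S.y) (Set.mem_univ _))
    positivity
  have h1 : 0 ≤ frobSq (dev S.y) / τ ^ 2 := div_nonneg (frobSq_nonneg _) (sq_nonneg _)
  have h2 : 0 ≤ frobSq (dev S.x) / τ ^ 2 := div_nonneg (frobSq_nonneg _) (sq_nonneg _)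
  have h3 : 0 ≤ γ ^ 2 * frobSq (dev S.s) := mul_nonneg (sq_nonneg _) (frobSq_nonneg _)
  have h4 : 0 ≤ m * ‖avg S.y - avg S.x‖ ^ 2 / τ ^ 2 := by positivity
  have h5 := frobSq_nonneg (dev S.z)
  rw [potential]
  linarith

lemma rate_arith {τ A B C : ℝ} (hτ0 : 0 < τ) (hτ : τ ≤ 1 / 20) (hB : 0 ≤ B) (hAB : B ≤ A)
    (hC : 0 ≤ C) : (1 - 3 / 5 * τ) * (A + (1 + τ) * B + C)
      ≤ (1 + τ) * ((1 - τ / 2) ^ 2 * (A + B + 15 / 7 * C)) := by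
  have h1 : 1 - 3 / 5 * τ ≤ (1 + τ) * (1 - τ / 2) ^ 2 := by nlinarith [mul_pos hτ0 hτ0]
  have h2 : (1 - 3 / 5 * τ) * C ≤ (1 + τ) * (1 - τ / 2) ^ 2 * (15 / 7 * C) := by
    apply mul_le_mul h1 (by linarith) hC (by positivity)
  have h3 : (1 - 3 / 5 * τ) * (A + (1 + τ) * B) ≤ (1 + τ) * (1 - τ / 2) ^ 2 * (A + B) := by
    have h4 : (1 - 3 / 5 * τ) * (A - B) ≤ (1 + τ) * (1 - τ / 2) ^ 2 * (A - B) :=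
      mul_le_mul_of_nonneg_right h1 (sub_nonneg.2 hAB)
    have h5 : (1 - 3 / 5 * τ) * (2 + τ) ≤ (1 + τ) * (1 - τ / 2) ^ 2 * 2 := by
      nlinarith [mul_pos hτ0 hτ0, mul_pos (mul_pos hτ0 hτ0) hτ0]
    have h6 := mul_le_mul_of_nonneg_right h5 hB
    linarith
  linarith

end Convergence

end ODAPG

end

theorem theorem1 (m d : ℕ) (hm : 2 ≤ m)
    (G : SimpleGraph (Fin m)) (W : Matrix (Fin m) (Fin m) ℝ) (hW : ODAPG.IsWeightMatrix G W)
    (L μ : ℝ) (hμ : 0 < μ) (hμL : μ ≤ L)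
    (f : Fin m → ODAPG.Vec d → ℝ) (hf : ∀ i, ODAPG.IsConvexSmooth L (f i))
    (g : ODAPG.Vec d → ℝ) (hg : StrongConvexOn Set.univ μ g)
    (xstar : ODAPG.Vec d) (hxstar : IsMinOn (ODAPG.objective f g) Set.univ xstar)
    (K : ℕ) (hK : 15 / √(1 - ODAPG.lambda2 hm hW.isHermitian) ≤ (K : ℝ))
    (γ : ℝ) (hγ : γ = 1 / (20 * √(L * μ))) (τ : ℝ) (hτ : τ = μ * γ)
    (x₁ : ODAPG.Vec d) (st : ℕ → ODAPG.State m d)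
    (hst : st = ODAPG.iterate f g
      (ODAPG.fastMix W (ODAPG.mixParam (ODAPG.lambda2 hm hW.isHermitian)) K) γ τ x₁)
    (c₁ c₂ c₃ : ℝ) (hc₁ : c₁ = 64) (hc₂ : c₂ = 9 * τ ^ 2 / 32) (hc₃ : c₃ = 5 * τ ^ 2 / 14)
    (T : ℕ) (hT : 1 ≤ T) :
    ODAPG.frobSq ((st T).z - ODAPG.ones xstar) ≤
      (1 - 1 / 40 * √(μ / L)) ^ T *
        (2 * (m : ℝ) / μ *
            (ODAPG.objective f g (ODAPG.avg (st 1).y) - ODAPG.objective f g xstar)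
          + ODAPG.frobSq ((st 1).z - ODAPG.ones xstar)
          + 6 * 20 ^ 2 * L / μ *
            (ODAPG.frobSq (ODAPG.lmul (ODAPG.projMat m) (st 1).x)
              + c₁ * ODAPG.frobSq (ODAPG.lmul (ODAPG.projMat m) (st 1).y)
              + c₂ * ODAPG.frobSq (ODAPG.lmul (ODAPG.projMat m) (st 1).z)
              + c₃ * γ ^ 2 * ODAPG.frobSq (ODAPG.lmul (ODAPG.projMat m) (st 1).s))) := by
  have hL : 0 < L := hμ.trans_le hμL
  have hm0 : m ≠ 0 := by omega
  have hsq : 0 < √(L * μ) := Real.sqrt_pos.2 (mul_pos hL hμ)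
  have hsq2 : √(L * μ) ^ 2 = L * μ := Real.sq_sqrt (mul_pos hL hμ).le
  have hγ0 : 0 < γ := by rw [hγ]; positivity
  have hτ0 : 0 < τ := hτ ▸ mul_pos hμ hγ0
  have hγ2 : 400 * (L * μ) * γ ^ 2 = 1 := by
    rw [hγ, ← hsq2]; field_simp; norm_num
  have hLτ : 400 * τ ^ 2 * L = μ := by rw [hτ]; linear_combination μ * hγ2
  have hrate : 1 / 40 * √(μ / L) = τ / 2 := by
    have : μ / L = (20 * τ) ^ 2 := by field_simp; linear_combination -hLτ
    rw [this, Real.sqrt_sq (by positivity)]; ring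
  have hτ1 : τ ≤ 1 / 20 := by
    have : μ * 1 ≤ μ * (1 / (400 * τ ^ 2)) := by
      have : L = μ * (1 / (400 * τ ^ 2)) := by field_simp; linear_combination hLτ
      rw [← this]; linarith
    have := le_of_mul_le_mul_left this hμ
    rw [le_div_iff₀ (by positivity)] at this
    nlinarith
  rw [hrate]
  have hinit : st 1 = ODAPG.initState f x₁ := by rw [hst]; rfl
  have hdev0 : ODAPG.dev (ODAPG.ones x₁ : ODAPG.Rows m d) = 0 := ODAPG.dev_ones hm0 x₁
  have havg : ODAPG.avg (ODAPG.ones x₁ : ODAPG.Rows m d) = x₁ := ODAPG.avg_ones hm0 x₁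
  simp only [hinit, ODAPG.lmul_projMat]
  have hC : 6 * 20 ^ 2 * L / μ * (ODAPG.frobSq (ODAPG.dev (ODAPG.initState f x₁).x)
      + c₁ * ODAPG.frobSq (ODAPG.dev (ODAPG.initState f x₁).y)
      + c₂ * ODAPG.frobSq (ODAPG.dev (ODAPG.initState f x₁).z)
      + c₃ * γ ^ 2 * ODAPG.frobSq (ODAPG.dev (ODAPG.initState f x₁).s))
      = 15 / 7 * (γ ^ 2 * ODAPG.frobSq (ODAPG.dev (ODAPG.initState f x₁).s)) := by
    simp only [ODAPG.initState, hdev0, ODAPG.frobSq_zero, hc₃]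
    have : 6 * 20 ^ 2 * L / μ * (5 * τ ^ 2 / 14) = 15 / 7 := by
      field_simp; linear_combination 210 * hLτ
    linear_combination (γ ^ 2 * ODAPG.frobSq (ODAPG.dev (ODAPG.gradRows f (ODAPG.ones x₁)))) * this
  have hA : 2 * (m : ℝ) / μ * (ODAPG.objective f g (ODAPG.avg (ODAPG.initState f x₁).y)
      - ODAPG.objective f g xstar) = 2 / μ * (m * ODAPG.objective f g
        (ODAPG.avg (ODAPG.initState f x₁).y) - m * ODAPG.objective f g xstar) := by ring
  have hB0 : 0 ≤ ODAPG.frobSq ((ODAPG.initState f x₁).z - ODAPG.ones xstar) :=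
    ODAPG.frobSq_nonneg _
  have hC0 : 0 ≤ γ ^ 2 * ODAPG.frobSq (ODAPG.dev (ODAPG.initState f x₁).s) :=
    mul_nonneg (sq_nonneg _) (ODAPG.frobSq_nonneg _)
  have hBA : ODAPG.frobSq ((ODAPG.initState f x₁).z - ODAPG.ones xstar)
      ≤ 2 / μ * (m * ODAPG.objective f g (ODAPG.avg (ODAPG.initState f x₁).y)
        - m * ODAPG.objective f g xstar) := by
    have h := ODAPG.quadratic_growth (ODAPG.strongConvexOn_objective hf hg) hxstar x₁
    simp only [ODAPG.initState]
    rw [ODAPG.frobSq_sub_ones hm0, hdev0, ODAPG.frobSq_zero, havg]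
    have h1 : μ / 2 * ‖x₁ - xstar‖ ^ 2
        ≤ ODAPG.objective f g x₁ - ODAPG.objective f g xstar := by linarith
    have h2 := mul_le_mul_of_nonneg_left h1 (by positivity : (0 : ℝ) ≤ 2 / μ * m)
    have e : 2 / μ * m * (μ / 2 * ‖x₁ - xstar‖ ^ 2) = m * ‖x₁ - xstar‖ ^ 2 := by field_simp
    linarith
  have hpot : ODAPG.potential f g μ γ τ xstar (ODAPG.initState f x₁)
      = 2 / μ * (m * ODAPG.objective f g (ODAPG.avg (ODAPG.initState f x₁).y)
          - m * ODAPG.objective f g xstar)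
        + (1 + τ) * ODAPG.frobSq ((ODAPG.initState f x₁).z - ODAPG.ones xstar)
        + γ ^ 2 * ODAPG.frobSq (ODAPG.dev (ODAPG.initState f x₁).s) := by
    simp only [ODAPG.potential, ODAPG.initState, hdev0, ODAPG.frobSq_zero, sub_self, norm_zero]
    ring
  rw [hC, hA]
  obtain _ | _ | t := T
  · omega
  · simp only [zero_add, hinit, pow_one]
    nlinarith
  · have h1 := ODAPG.potential_iterate_le hm0 (hW.isMixing hm hK) hμ hL hγ0 hτ hτ1 hγ2 hf hg
      hxstar x₁ (t + 1)
    rw [← hst, hpot, pow_succ, mul_assoc] at h1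
    have h2 := ODAPG.frobSq_z_le_potential (γ := γ) (τ := τ) hμ hxstar (st (t + 1 + 1))
    have h3 := ODAPG.rate_arith hτ0 hτ1 hB0 hBA hC0
    have h4 : (1 - 3 / 5 * τ) ^ t ≤ (1 - τ / 2) ^ t :=
      pow_le_pow_left₀ (by linarith) (by linarith) t
    have h5 := mul_le_mul h4 h3
      (mul_nonneg (by linarith) (by nlinarith)) (pow_nonneg (by linarith) t)
    refine le_of_mul_le_mul_left ((h2.trans (h1.trans h5)).trans (le_of_eq ?_))
      (by linarith : 0 < 1 + τ)
    ring
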